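/- Let $G$ be an infinite bounded Abelian group (that is, $mG=0$ for some integer $m\ge 1$), let $H$ be a countable (finite or infinite) subgroup of $G$, and let $N=\exp(H)$ be the least common multiple of the orders of the elements of $H$. For a group topology $\tau$ on $G$, let $\mathbf{n}(G,\tau)$ denote the von Neumann radical of $(G,\tau)$, i.e. the intersection of the kernels of all continuous characters $(G,\tau)\to\mathbb{T}$, where $\mathbb{T}$ is the circle group. Then the following assertions are equivalent: 1. $G$ contains a subgroup isomorphic to $\mathbb{Z}(N)^{(\omega)}$, the direct sum of countably infinitely many copies of the cyclic group $\mathbb{Z}(N)$ of order $N$; 2. $H\in\mathcal{NRC}(G)$, i.e. there is a complete non-discrete Hausdorff group topology $\tau$ on $G$ with $\mathbf{n}(G,\tau)=H$; 3. $H\in\mathcal{NR}(G)$, i.e. there is a non-discrete Hausdorff group topology $\tau$ on $G$ with $\mathbf{n}(G,\tau)=H$. -/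

import Mathlib

/-- The von Neumann radical of a topological Abelian group: the intersection of the kernels of all
continuous characters, i.e. of all continuous homomorphisms to the circle group. -/
noncomputable def vonNeumannRadical (G : Type*) [AddCommGroup G] [TopologicalSpace G] : AddSubgroup G :=
  ⨅ (χ : AddChar G Circle) (_ : Continuous χ), χ.toAddMonoidHom.ker

theorem mem_vonNeumannRadical {G : Type*} [AddCommGroup G] [TopologicalSpace G] {x : G} :
    x ∈ vonNeumannRadical G ↔ ∀ χ : AddChar G Circle, Continuous χ → χ x = 1 := by
  simp only [vonNeumannRadical, AddSubgroup.mem_iInf, AddMonoidHom.mem_ker]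
  exact Iff.rfl

/-- `NR(G)`: the set of all subgroups of `G` which are the von Neumann radical of `G` for some
non-discrete Hausdorff group topology on `G`. -/
def NR (G : Type*) [AddCommGroup G] : Set (AddSubgroup G) :=
  {H | ∃ (_ : TopologicalSpace G) (_ : IsTopologicalAddGroup G),
    T2Space G ∧ ¬ DiscreteTopology G ∧ vonNeumannRadical G = H}

/-- `NRC(G)`: the set of all subgroups of `G` which are the von Neumann radical of `G` for some
complete non-discrete Hausdorff group topology on `G` (complete: with respect to the canonical
uniform structure of the topological group). -/
def NRC (G : Type*) [AddCommGroup G] : Set (AddSubgroup G) :=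
  {H | ∃ (_ : TopologicalSpace G) (_ : IsTopologicalAddGroup G),
    T2Space G ∧ @CompleteSpace G (IsTopologicalAddGroup.rightUniformSpace G) ∧
      ¬ DiscreteTopology G ∧ vonNeumannRadical G = H}

/-- `G` contains a subgroup isomorphic to `Z(N)^(ω)`, the direct sum of countably infinitely many
copies of the cyclic group `Z(N)` of order `N`. -/
def ContainsOmegaSum (G : Type*) [AddCommGroup G] (N : ℕ) : Prop :=
  ∃ K : AddSubgroup G, Nonempty (K ≃+ (ℕ →₀ ZMod N))

/-! Necessity rests on two facts. If `nG` is finite, characters of this finite Hausdorff group pull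
back along `x ↦ n • x` to continuous characters of `G`, so `n` kills the radical. Write `exp G = p ^
a * m'` with `p ∤ m'`, and let `p ^ (k + 1) ∣ exp H`. Then `p ^ k * m'` does not kill `H`, so `(p ^
k * m')G` is infinite. It is a `p`-group, so its `p`-socle is infinite, which yields `Z(p ^ (k +
1))^(ω)`; coprime prime powers are then combined.

Sufficiency: let `h` list `H`, each element infinitely often, and choose an independent sequence `f`
of elements of order `N` in the copy of `Z(N)^(ω)`. Take the finest group topology in which `f n`
and `h n + f (n, 0) + ⋯ + f (n, n)` tend to `0`. A continuous character has `N`-th roots of unity as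
values on both sequences, so it is eventually `1` on them, hence on `h n`, and so it kills `H`.
Conversely, `f` is chosen so that enough characters killing `H` are eventually `1` on `f`, hence
continuous. The growing number of `f`'s in a block makes the topology Hausdorff
(`notMem_sumNhd_blockSequence`); completeness holds for every null sequence
(`NullSequence.completeSpace`). -/

open Filter Topology Pointwise Finset

/-! ### The finest group topology of a null sequence and its completeness -/

/-- A decreasing sequence of symmetric sets containing `0` that differ from each other by finitely
many points: the sets of terms of a sequence (and of its negative) from a given index on. -/
structure NullSequence (G : Type*) [AddCommGroup G] where
  tail : ℕ → Set G
  zero_mem : ∀ n, 0 ∈ tail n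
  anti : Antitone tail
  neg_mem : ∀ n, ∀ x ∈ tail n, -x ∈ tail n
  finite_diff : ∀ n, (tail 0 \ tail n).Finite

namespace NullSequence

variable {G : Type*} [AddCommGroup G] (A : NullSequence G)

/-- The sums `a 0 + ⋯ + a (k - 1)` with `a i ∈ A.tail (s i)`. -/
def partialSums (s : ℕ → ℕ) (k : ℕ) : Set G := ∑ i ∈ range k, A.tail (s i)

/-- All finite sums `a 0 + ⋯ + a (k - 1)` with `a i ∈ A.tail (s i)`. -/
def sumNhd (s : ℕ → ℕ) : Set G := ⋃ k, A.partialSums s k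

variable {A}

theorem partialSums_zero (s : ℕ → ℕ) : A.partialSums s 0 = 0 := by simp [partialSums]

theorem partialSums_succ (s : ℕ → ℕ) (k : ℕ) :
    A.partialSums s (k + 1) = A.partialSums s k + A.tail (s k) := by
  simp [partialSums, sum_range_succ]

theorem partialSums_mono (s : ℕ → ℕ) : Monotone (A.partialSums s) := by
  refine monotone_nat_of_le_succ fun k => ?_
  rw [partialSums_succ]
  intro x hx
  simpa using Set.add_mem_add hx (A.zero_mem (s k))

theorem partialSums_anti {s t : ℕ → ℕ} (h : ∀ i, s i ≤ t i) (k : ℕ) :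
    A.partialSums t k ⊆ A.partialSums s k :=
  Set.finsetSum_subset_finsetSum _ _ _ fun i _ => A.anti (h i)

theorem partialSums_add (s : ℕ → ℕ) (j k : ℕ) :
    A.partialSums s (j + k) = A.partialSums s j + A.partialSums (fun i => s (j + i)) k := by
  simp [partialSums, sum_range_add]

theorem partialSums_two_mul (s : ℕ → ℕ) (k : ℕ) :
    A.partialSums s (2 * k) =
      A.partialSums (fun i => s (2 * i)) k + A.partialSums (fun i => s (2 * i + 1)) k := by
  induction k with
  | zero => simp [partialSums_zero]
  | succ k ih =>
    rw [show 2 * (k + 1) = 2 * k + 1 + 1 by ring, partialSums_succ, partialSums_succ, ih,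
      partialSums_succ, partialSums_succ]
    abel

theorem neg_mem_partialSums {s : ℕ → ℕ} {k : ℕ} {x : G} (hx : x ∈ A.partialSums s k) :
    -x ∈ A.partialSums s k := by
  induction k generalizing x with
  | zero => simpa [partialSums_zero] using hx
  | succ k ih =>
    rw [partialSums_succ] at hx ⊢
    obtain ⟨y, hy, z, hz, rfl⟩ := hx
    rw [neg_add]
    exact Set.add_mem_add (ih hy) (A.neg_mem _ _ hz)

theorem sumNhd_anti {s t : ℕ → ℕ} (h : ∀ i, s i ≤ t i) : A.sumNhd t ⊆ A.sumNhd s :=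
  Set.iUnion_mono fun k => partialSums_anti h k

theorem zero_mem_sumNhd (s : ℕ → ℕ) : (0 : G) ∈ A.sumNhd s :=
  Set.mem_iUnion.2 ⟨0, by simp [partialSums_zero]⟩

theorem tail_subset_sumNhd (s : ℕ → ℕ) : A.tail (s 0) ⊆ A.sumNhd s := fun x hx =>
  Set.mem_iUnion.2 ⟨1, by simpa [partialSums] using hx⟩

theorem neg_mem_sumNhd {s : ℕ → ℕ} {x : G} (hx : x ∈ A.sumNhd s) : -x ∈ A.sumNhd s := by
  obtain ⟨k, hk⟩ := Set.mem_iUnion.1 hx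
  exact Set.mem_iUnion.2 ⟨k, neg_mem_partialSums hk⟩

/-- The two sums are interleaved: one fills the even slots of `s`, the other the odd slots. -/
theorem sumNhd_add_subset (s : ℕ → ℕ) :
    A.sumNhd (fun i => max (s (2 * i)) (s (2 * i + 1))) +
      A.sumNhd (fun i => max (s (2 * i)) (s (2 * i + 1))) ⊆ A.sumNhd s := by
  rintro _ ⟨x, hx, y, hy, rfl⟩
  obtain ⟨j, hj⟩ := Set.mem_iUnion.1 hx
  obtain ⟨k, hk⟩ := Set.mem_iUnion.1 hy
  refine Set.mem_iUnion.2 ⟨2 * max j k, ?_⟩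
  rw [partialSums_two_mul]
  exact Set.add_mem_add
    (partialSums_anti (fun i => le_max_left _ _) _ (partialSums_mono _ (le_max_left j k) hj))
    (partialSums_anti (fun i => le_max_right _ _) _ (partialSums_mono _ (le_max_right j k) hk))

variable (A) in
/-- The neighbourhoods of `0` of the finest group topology for which the null sequence tends
to `0`. -/
@[reducible]
def basis : AddGroupFilterBasis G :=
  addGroupFilterBasisOfComm (Set.range A.sumNhd) (Set.range_nonempty _)
    (by
      rintro _ _ ⟨s, rfl⟩ ⟨t, rfl⟩
      exact ⟨_, ⟨fun i => max (s i) (t i), rfl⟩, Set.subset_inter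
        (sumNhd_anti fun i => le_max_left _ _) (sumNhd_anti fun i => le_max_right _ _)⟩)
    (by
      rintro _ ⟨s, rfl⟩
      exact zero_mem_sumNhd s)
    (by
      rintro _ ⟨s, rfl⟩
      exact ⟨_, ⟨_, rfl⟩, sumNhd_add_subset s⟩)
    (by
      rintro _ ⟨s, rfl⟩
      exact ⟨_, ⟨s, rfl⟩, fun x hx => neg_mem_sumNhd hx⟩)

variable (A) in
/-- The finest group topology for which the null sequence tends to `0`. -/
@[reducible]
def topology : TopologicalSpace G := A.basis.topology

theorem isTopologicalAddGroup : @IsTopologicalAddGroup G A.topology _ :=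
  A.basis.isTopologicalAddGroup

theorem nhds_zero_hasBasis :
    (@nhds G A.topology 0).HasBasis (fun _ : ℕ → ℕ => True) A.sumNhd := by
  refine A.basis.nhds_zero_hasBasis.to_hasBasis ?_ fun s _ => ⟨_, ⟨s, rfl⟩, subset_rfl⟩
  rintro _ ⟨s, rfl⟩
  exact ⟨s, trivial, subset_rfl⟩

/-- An ultrafilter on `A.tail 0` either contains every tail, and so tends to `0`, or lives on a
finite difference. -/
theorem isCompact_tail_zero : @IsCompact G A.topology (A.tail 0) := by
  let := A.topology
  rw [isCompact_iff_ultrafilter_le_nhds]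
  intro F hF
  by_cases h : ∀ n, A.tail n ∈ F
  · refine ⟨0, A.zero_mem 0, nhds_zero_hasBasis.ge_iff.2 fun s _ => ?_⟩
    exact mem_of_superset (h (s 0)) (tail_subset_sumNhd s)
  · push Not at h
    obtain ⟨n, hn⟩ := h
    have hmem : A.tail 0 \ A.tail n ∈ F :=
      inter_mem (le_principal_iff.1 hF) (Ultrafilter.compl_mem_iff_notMem.2 hn)
    obtain ⟨x, hx, hFx⟩ := isCompact_iff_ultrafilter_le_nhds.1 (A.finite_diff n).isCompact F
      (le_principal_iff.2 hmem)
    exact ⟨x, hx.1, hFx⟩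

theorem isCompact_partialSums (k : ℕ) : @IsCompact G A.topology (A.partialSums 0 k) := by
  let := A.topology
  have := A.isTopologicalAddGroup
  induction k with
  | zero => simp [partialSums_zero, ← Set.singleton_zero]
  | succ k ih =>
    rw [partialSums_succ]
    exact ih.add isCompact_tail_zero

/-- For given neighbourhoods `sumNhd (t k)` of `0`, a neighbourhood contained in every
`partialSums 0 k + sumNhd (t k)`. -/
theorem exists_sumNhd_subset (t : ℕ → ℕ → ℕ) :
    ∃ s, ∀ k, A.sumNhd s ⊆ A.partialSums 0 k + A.sumNhd (t k) := by
  -- `s j` is the maximum of `t k (j - k)` over `k ≤ j`, so `s` shifted by `k` dominates `t k` for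
  -- every `k` at once.
  refine ⟨fun j => (range (j + 1)).sup fun k => t k (j - k), fun k x hx => ?_⟩
  obtain ⟨m, hm⟩ := Set.mem_iUnion.1 hx
  have hm' := partialSums_mono _ (Nat.le_add_left m k) hm
  rw [partialSums_add] at hm'
  refine Set.add_subset_add (partialSums_anti (fun i => Nat.zero_le _) k) ?_ hm'
  refine (partialSums_anti (fun i => ?_) m).trans (Set.subset_iUnion _ m)
  have := Finset.le_sup (f := fun l => t l (k + i - l)) (mem_range.2 (by omega : k < k + i + 1))
  simpa using this

theorem exists_sumNhd_add_subset (s : ℕ → ℕ) :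
    ∃ t, A.sumNhd t + A.sumNhd t + A.sumNhd t ⊆ A.sumNhd s := by
  set s' : ℕ → ℕ := fun i => max (s (2 * i)) (s (2 * i + 1)) with hs'
  refine ⟨fun i => max (s' (2 * i)) (s' (2 * i + 1)), ?_⟩
  refine (Set.add_subset_add (sumNhd_add_subset s') ?_).trans (sumNhd_add_subset s)
  intro x hx
  have := Set.add_mem_add hx (A.zero_mem_sumNhd fun i => max (s' (2 * i)) (s' (2 * i + 1)))
  rw [add_zero] at this
  exact sumNhd_add_subset s' this

/-- A Cauchy filter concentrates near a translate of one compact set `partialSums 0 k`; a cluster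
point of the approximating centres there is its limit. -/
theorem completeSpace :
    letI := A.topology
    haveI := A.isTopologicalAddGroup
    @CompleteSpace G (IsTopologicalAddGroup.rightUniformSpace G) := by
  let := A.topology
  have := A.isTopologicalAddGroup
  let := IsTopologicalAddGroup.rightUniformSpace G
  refine ⟨fun {F} hF => ?_⟩
  have := hF.1
  have hnhd (s : ℕ → ℕ) : A.sumNhd s ∈ 𝓝 (0 : G) := nhds_zero_hasBasis.mem_of_mem trivial
  -- small translates in the filter
  have hsmall (s : ℕ → ℕ) : ∃ x : G, (x +ᵥ A.sumNhd s : Set G) ∈ F := by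
    have hU : (fun p : G × G => p.2 + -p.1) ⁻¹' A.sumNhd s ∈ uniformity G :=
      preimage_mem_comap (hnhd s)
    obtain ⟨t, ht, hts⟩ := (cauchy_iff.1 hF).2 _ hU
    obtain ⟨x, hx⟩ := F.nonempty_of_mem ht
    refine ⟨x, mem_of_superset ht fun y hy => ?_⟩
    refine ⟨y - x, ?_, by simp⟩
    have := hts (Set.mk_mem_prod hx hy)
    simpa [sub_eq_add_neg] using this
  obtain ⟨x₀, hx₀⟩ := hsmall 0
  have key : ∃ k, ∀ s, ∃ x ∈ x₀ +ᵥ A.partialSums 0 k, (x +ᵥ A.sumNhd s : Set G) ∈ F := by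
    -- If each `k` fails at some `s k`, one `r` is taken that serves all `k`, since the relevant
    -- index `i + j` is known only after `x₁`, which depends on `r`. The centre `x₂` is then moved
    -- into `x₀ + partialSums 0 (2 * (i + j))`.
    by_contra! h
    choose s hs using h
    choose t ht using fun k => exists_sumNhd_add_subset (A := A) (s k)
    obtain ⟨r, hr⟩ := exists_sumNhd_subset (A := A) fun k => t (2 * k)
    obtain ⟨x₁, hx₁⟩ := hsmall r
    obtain ⟨y, ⟨a, ha, hay⟩, b, hb, hby⟩ := F.nonempty_of_mem (inter_mem hx₀ hx₁)
    obtain ⟨i, hi⟩ := Set.mem_iUnion.1 ha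
    obtain ⟨j, hj⟩ := Set.mem_iUnion.1 hb
    simp only [vadd_eq_add] at hay hby
    have hj' : -b ∈ A.partialSums 0 j :=
      neg_mem_partialSums (partialSums_anti (fun i => Nat.zero_le _) j hj)
    have hab : a - b ∈ A.partialSums 0 (i + j) := by
      rw [partialSums_add, sub_eq_add_neg]
      exact Set.add_mem_add hi hj'
    obtain ⟨x₂, hx₂⟩ := hsmall (t (2 * (i + j)))
    obtain ⟨z, ⟨c, hc, hcz⟩, d, hd, hdz⟩ := F.nonempty_of_mem (inter_mem hx₁ hx₂)
    simp only [vadd_eq_add] at hcz hdz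
    obtain ⟨e, he, u, hu, heu⟩ := hr (i + j) hc
    simp only at heu
    have hx : a - b + e ∈ A.partialSums 0 (2 * (i + j)) := by
      rw [two_mul, partialSums_add]
      exact Set.add_mem_add hab he
    refine hs (2 * (i + j)) (x₀ + (a - b + e)) ⟨_, hx, rfl⟩ (mem_of_superset hx₂ ?_)
    rintro _ ⟨w, hw, rfl⟩
    refine ⟨u + -d + w, ht _ (Set.add_mem_add (Set.add_mem_add hu (neg_mem_sumNhd hd)) hw), ?_⟩
    simp only [vadd_eq_add]
    have h1 : x₂ = x₁ + c - d := by rw [hcz, ← hdz]; abel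
    have h2 : x₁ = x₀ + a - b := by rw [hay, ← hby]; abel
    rw [h1, h2, ← heu]
    abel
  obtain ⟨k, hk⟩ := key
  -- `C U` is the set of centres in the compact set whose `U`-translate belongs to `F`.
  set C : Set G → Set G := fun U => {x | x ∈ x₀ +ᵥ A.partialSums 0 k ∧ x +ᵥ U ∈ F} with hC
  have hCmono : Monotone C := fun U V hUV x hx =>
    ⟨hx.1, mem_of_superset hx.2 (Set.vadd_set_mono hUV)⟩
  have hne : ((𝓝 (0 : G)).lift' C).NeBot := by
    rw [lift'_neBot_iff hCmono]
    intro U hU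
    obtain ⟨s, -, hs⟩ := nhds_zero_hasBasis.mem_iff.1 hU
    obtain ⟨x, hx, hxF⟩ := hk s
    exact ⟨x, hx, mem_of_superset hxF (Set.vadd_set_mono hs)⟩
  have hcomp : IsCompact (x₀ +ᵥ A.partialSums 0 k) := (isCompact_partialSums k).vadd x₀
  obtain ⟨z, -, hz⟩ := hcomp (f := (𝓝 (0 : G)).lift' C)
    (le_principal_iff.2 (mem_of_superset (mem_lift' univ_mem) fun x hx => hx.1))
  refine ⟨z, ?_⟩
  have hbz : (𝓝 z).HasBasis (fun _ : ℕ → ℕ => True) fun s => z +ᵥ A.sumNhd s := by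
    have := (nhds_zero_hasBasis (A := A)).map (z + ·)
    rwa [map_add_left_nhds_zero] at this
  refine hbz.ge_iff.2 fun s _ => ?_
  set t : ℕ → ℕ := fun i => max (s (2 * i)) (s (2 * i + 1))
  obtain ⟨x, ⟨a, ha, hax⟩, hx⟩ := clusterPt_iff_nonempty.1 hz (hbz.mem_of_mem (i := t) trivial)
    (mem_lift' (hnhd t))
  refine mem_of_superset hx.2 ?_
  rintro _ ⟨b, hb, rfl⟩
  refine ⟨a + b, sumNhd_add_subset s (Set.add_mem_add ha hb), ?_⟩
  simp only [vadd_eq_add] at hax ⊢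
  rw [← hax, add_assoc]

end NullSequence

/-! ### The block sequence and its linear combinations -/

section BlockSequence

variable {G : Type*} [AddCommGroup G]

/-- The terms `h n + f (n, 0) + ⋯ + f (n, n)`, where the pairs are coded by `Nat.pair`. -/
def blockTerm (f h : ℕ → G) (n : ℕ) : G := h n + ∑ j ∈ range (n + 1), f (Nat.pair n j)

/-- The null sequence which consists of the `f n` and the `blockTerm f h n`. -/
def blockSequence (f h : ℕ → G) : NullSequence G where
  tail m := {x | x = 0 ∨ ∃ n, m ≤ n ∧ x ∈ ({f n, -f n, blockTerm f h n, -blockTerm f h n} : Set G)}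
  zero_mem _ := Or.inl rfl
  anti m m' hm x hx := hx.imp id fun ⟨n, hn, h⟩ => ⟨n, hm.trans hn, h⟩
  neg_mem m x hx := by
    rcases hx with rfl | ⟨n, hn, hx⟩
    · simp
    · refine Or.inr ⟨n, hn, ?_⟩
      rcases hx with rfl | rfl | rfl | rfl <;> simp
  finite_diff m := by
    refine ((Set.finite_Iio m).biUnion fun n _ => Set.toFinite
      ({f n, -f n, blockTerm f h n, -blockTerm f h n} : Set G)).subset ?_
    rintro x ⟨hx, hx'⟩
    simp only [Set.mem_ofPred_eq, not_or, not_exists, not_and] at hx hx'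
    obtain ⟨n, -, hn⟩ := hx.resolve_left hx'.1
    exact Set.mem_biUnion (Set.mem_Iio.2 (not_le.1 fun h => hx'.2 n h hn)) hn

theorem mem_tail_blockSequence {f h : ℕ → G} {m : ℕ} {x : G} :
    x ∈ (blockSequence f h).tail m ↔ x = 0 ∨ ∃ n, m ≤ n ∧
      (x = f n ∨ x = -f n ∨ x = blockTerm f h n ∨ x = -blockTerm f h n) := Iff.rfl

/-- Sums of terms of the block sequence as linear combinations. -/
theorem exists_linearCombination_of_mem_partialSums {f h : ℕ → G} {s : ℕ → ℕ} {k : ℕ} {x : G}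
    (hx : x ∈ (blockSequence f h).partialSums s k) :
    ∃ (c d : ℕ →₀ ℤ) (t : ℕ → ℕ), (∀ i, s i ≤ t i) ∧ (∀ n, c n ≠ 0 → ∃ j, s j ≤ n) ∧
      (∀ i, d i ≠ 0 → ∃ j < k, t j = i) ∧
      x = Finsupp.linearCombination ℤ (blockTerm f h) c + Finsupp.linearCombination ℤ f d := by
  induction k generalizing x with
  | zero =>
    rw [NullSequence.partialSums_zero] at hx
    -- `t j` records the index of the `f` used in slot `j`; it keeps the default `s j` in the other
    -- slots, so that `s ≤ t` everywhere.
    exact ⟨0, 0, s, fun _ => le_rfl, by simp, by simp, by simpa using hx⟩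
  | succ k ih =>
    rw [NullSequence.partialSums_succ] at hx
    obtain ⟨y, hy, z, hz, rfl⟩ := hx
    obtain ⟨c, d, t, ht, hc, hd, rfl⟩ := ih hy
    have hf (n : ℕ) (hn : s k ≤ n) (e : ℤ) :
        ∃ (c' d' : ℕ →₀ ℤ) (t : ℕ → ℕ), (∀ i, s i ≤ t i) ∧ (∀ n, c' n ≠ 0 → ∃ j, s j ≤ n) ∧
          (∀ i, d' i ≠ 0 → ∃ j < k + 1, t j = i) ∧
          Finsupp.linearCombination ℤ (blockTerm f h) c + Finsupp.linearCombination ℤ f d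
            + e • f n = Finsupp.linearCombination ℤ (blockTerm f h) c' +
              Finsupp.linearCombination ℤ f d' := by
      refine ⟨c, d + Finsupp.single n e, Function.update t k n, fun i => ?_, hc, fun i hi => ?_, ?_⟩
      · by_cases hik : i = k
        · subst hik; simpa using hn
        · simpa [hik] using ht i
      · by_cases hin : n = i
        · exact ⟨k, by omega, by simpa using hin⟩
        · rw [Finsupp.add_apply, Finsupp.single_eq_of_ne (Ne.symm hin), add_zero] at hi
          obtain ⟨j, hj, rfl⟩ := hd i hi
          exact ⟨j, by omega, by simp [hj.ne]⟩
      · simp [add_assoc]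
    have hv (n : ℕ) (hn : s k ≤ n) (e : ℤ) :
        ∃ (c' d' : ℕ →₀ ℤ) (t : ℕ → ℕ), (∀ i, s i ≤ t i) ∧ (∀ n, c' n ≠ 0 → ∃ j, s j ≤ n) ∧
          (∀ i, d' i ≠ 0 → ∃ j < k + 1, t j = i) ∧
          Finsupp.linearCombination ℤ (blockTerm f h) c + Finsupp.linearCombination ℤ f d
            + e • blockTerm f h n = Finsupp.linearCombination ℤ (blockTerm f h) c' +
              Finsupp.linearCombination ℤ f d' := by
      refine ⟨c + Finsupp.single n e, d, t, ht, fun i hi => ?_, fun i hi => ?_, ?_⟩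
      · by_cases hin : n = i
        · exact ⟨k, hin ▸ hn⟩
        · rw [Finsupp.add_apply, Finsupp.single_eq_of_ne (Ne.symm hin), add_zero] at hi
          exact hc i hi
      · obtain ⟨j, hj, hji⟩ := hd i hi
        exact ⟨j, by omega, hji⟩
      · simp only [map_add, Finsupp.linearCombination_single]
        abel
    rcases mem_tail_blockSequence.1 hz with rfl | ⟨n, hn, rfl | rfl | rfl | rfl⟩
    · simpa using hf (s k) le_rfl 0
    · simpa using hf n hn 1
    · simpa using hf n hn (-1)
    · simpa using hv n hn 1
    · simpa using hv n hn (-1)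

/-- The coefficients of the `f i` in a linear combination of block terms. -/
noncomputable def blockCoeff (c : ℕ →₀ ℤ) : ℕ →₀ ℤ :=
  Finsupp.linearCombination ℤ
    (fun n => ∑ j ∈ range (n + 1), (Finsupp.single (Nat.pair n j) 1 : ℕ →₀ ℤ)) c

/-- Different blocks use disjoint sets of `f`'s, so every `f (n, j)` with `j ≤ n` carries exactly
the coefficient of block `n`. -/
theorem blockCoeff_apply (c : ℕ →₀ ℤ) (i : ℕ) :
    blockCoeff c i = if i.unpair.2 ≤ i.unpair.1 then c i.unpair.1 else 0 := by
  induction c using Finsupp.induction_linear with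
  | zero => simp [blockCoeff]
  | add c d hc hd =>
    rw [blockCoeff, map_add, Finsupp.add_apply, ← blockCoeff, ← blockCoeff, hc, hd]
    split_ifs <;> simp
  | single n z =>
    have hpair (j : ℕ) : Nat.pair n j = i ↔ n = i.unpair.1 ∧ j = i.unpair.2 := by
      conv_lhs => rw [← Nat.pair_unpair i]
      exact Nat.pair_eq_pair
    simp only [blockCoeff, Finsupp.linearCombination_single, Finsupp.smul_apply,
      Finsupp.finsetSum_apply, Finsupp.single_apply, hpair, smul_eq_mul]
    by_cases hn : n = i.unpair.1
    · simp [hn, Finset.sum_ite_eq']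
    · simp [hn]

theorem linearCombination_blockTerm (f h : ℕ → G) (c : ℕ →₀ ℤ) :
    Finsupp.linearCombination ℤ (blockTerm f h) c =
      Finsupp.linearCombination ℤ h c + Finsupp.linearCombination ℤ f (blockCoeff c) := by
  induction c using Finsupp.induction_linear with
  | zero => simp [blockCoeff]
  | add c d hc hd =>
    have : blockCoeff (c + d) = blockCoeff c + blockCoeff d := by simp [blockCoeff]
    rw [map_add, map_add, this, map_add, hc, hd]
    abel
  | single n z => simp [blockCoeff, blockTerm, map_sum]

/-! ### Separation of points -/

variable {f h : ℕ → G} {F : ℕ → AddSubgroup G} {N : ℕ}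

/-- At the largest bad index `l`, the later terms vanish and the earlier ones lie in `F l`, so `a l
• f l ∈ F l`. -/
theorem dvd_of_linearCombination_mem (hF : Monotone F) (hfF : ∀ n, f n ∈ F (n + 1))
    (hind : ∀ n, ∀ d : ℤ, d • f n ∈ F n → (N : ℤ) ∣ d) (hfN : ∀ n, N • f n = 0)
    {a : ℕ →₀ ℤ} {n : ℕ} (ha : Finsupp.linearCombination ℤ f a ∈ F n) {i : ℕ} (hi : n ≤ i) :
    (N : ℤ) ∣ a i := by
  by_contra hai
  have hmem : i ∈ a.support.filter fun i => n ≤ i ∧ ¬ (N : ℤ) ∣ a i := by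
    simp only [mem_filter, Finsupp.mem_support_iff]
    exact ⟨fun h0 => hai (h0 ▸ dvd_zero _), hi, hai⟩
  obtain ⟨l, hl, hmax⟩ := Finset.exists_max_image _ id ⟨i, hmem⟩
  simp only [mem_filter, id] at hl hmax
  obtain ⟨hl, hnl, hal⟩ := hl
  refine hal (hind l _ ?_)
  have hsum := Finset.add_sum_erase a.support (fun j => a j • f j) hl
  rw [Finsupp.linearCombination_apply, Finsupp.sum, ← hsum] at ha
  refine (AddSubgroup.add_mem_cancel_right _ (sum_mem fun j hj => ?_)).1 (hF hnl ha)
  obtain ⟨hjl, hj⟩ := mem_erase.1 hj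
  rcases lt_or_gt_of_ne hjl with hlt | hgt
  · exact AddSubgroup.zsmul_mem _ (hF hlt (hfF j)) _
  · have : (N : ℤ) ∣ a j := by
      by_contra hN
      exact absurd (hmax j ⟨hj, hnl.trans hgt.le, hN⟩) (not_le.2 hgt)
    obtain ⟨b, hb⟩ := this
    rw [hb, mul_comm, mul_smul, natCast_zsmul, hfN, smul_zero]
    exact zero_mem _

theorem smul_eq_zero_of_natCast_dvd {x : G} (hx : N • x = 0) {z : ℤ} (hz : (N : ℤ) ∣ z) :
    z • x = 0 := by
  obtain ⟨b, rfl⟩ := hz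
  rw [mul_comm, mul_smul, natCast_zsmul, hx, smul_zero]

/-- A block `l` brings in `l + 1` separate `f`'s, while the individually added `f`'s are too sparse
to cancel them all. Hence all block coefficients are divisible by `N`, and independence of `f`
forces `g = 0`. -/
theorem notMem_sumNhd_blockSequence (hF : Monotone F) (hfF : ∀ n, f n ∈ F (n + 1))
    (hhF : ∀ n, h n ∈ F n) (hind : ∀ n, ∀ d : ℤ, d • f n ∈ F n → (N : ℤ) ∣ d)
    (hfN : ∀ n, N • f n = 0) (hhN : ∀ n, N • h n = 0) {m : ℕ} {g : G} (hg : g ∈ F m)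
    (hg0 : g ≠ 0) :
    g ∉ (blockSequence f h).sumNhd fun i => m + Nat.pair i i + 1 := by
  intro hmem
  obtain ⟨k, hk⟩ := Set.mem_iUnion.1 hmem
  obtain ⟨c, d, t, ht, hc, hd, hgcd⟩ := exists_linearCombination_of_mem_partialSums hk
  have hc' (n : ℕ) (hn : c n ≠ 0) : m ≤ n := by
    obtain ⟨j, hj⟩ := hc n hn
    omega
  rw [linearCombination_blockTerm, add_assoc, ← map_add] at hgcd
  have hcN (n : ℕ) : (N : ℤ) ∣ c n := by
    by_contra hn
    have hn' : n ∈ c.support.filter fun n => ¬ (N : ℤ) ∣ c n := by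
      simp only [mem_filter, Finsupp.mem_support_iff]
      exact ⟨fun h0 => hn (h0 ▸ dvd_zero _), hn⟩
    obtain ⟨l, hl, hmax⟩ := Finset.exists_max_image _ id ⟨n, hn'⟩
    simp only [mem_filter, Finsupp.mem_support_iff, id] at hl hmax
    have hlc : Finsupp.linearCombination ℤ h c ∈ F l := by
      rw [Finsupp.linearCombination_apply]
      refine sum_mem fun j hj => ?_
      rw [Finsupp.mem_support_iff] at hj
      rcases le_or_gt j l with hjl | hjl
      · exact AddSubgroup.zsmul_mem _ (hF hjl (hhF j)) _
      · have : (N : ℤ) ∣ c j := by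
          by_contra hN
          exact absurd (hmax j ⟨hj, hN⟩) (not_le.2 hjl)
        simp only [smul_eq_zero_of_natCast_dvd (hhN j) this, zero_mem]
    have hfl : Finsupp.linearCombination ℤ f (blockCoeff c + d) ∈ F l := by
      rw [← add_sub_cancel_left (Finsupp.linearCombination ℤ h c)
        (Finsupp.linearCombination ℤ f (blockCoeff c + d)), ← hgcd]
      exact sub_mem (hF (hc' l hl.1) hg) hlc
    -- Pigeonhole: slots `u ≥ l` only use indices above `Nat.pair u u ≥ Nat.pair l l`, so at most
    -- `l` slots can reach the `l + 1` indices of block `l`.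
    obtain ⟨j, hjl, hdj⟩ : ∃ j ≤ l, d (Nat.pair l j) = 0 := by
      by_contra! hne
      choose! u hu hut using fun j (hj : j ≤ l) => hd _ (hne j hj)
      have hul (j : ℕ) (hj : j ≤ l) : u j < l := by
        by_contra hlt
        have h1 := (ht (u j)).trans_eq (hut j hj)
        have h2 : Nat.pair l j ≤ Nat.pair l l := by
          rcases hj.eq_or_lt with rfl | hj
          · exact le_rfl
          · exact (Nat.pair_lt_pair_right l hj).le
        have h3 : Nat.pair l l ≤ Nat.pair (u j) (u j) := by
          rcases (not_lt.1 hlt).eq_or_lt with h | h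
          · rw [← h]
          · exact ((Nat.pair_lt_pair_left l h).trans (Nat.pair_lt_pair_right _ h)).le
        omega
      obtain ⟨x, hx, y, hy, hxy, huxy⟩ := Finset.exists_ne_map_eq_of_card_lt_of_maps_to
        (s := range (l + 1)) (t := range l) (by simp) (f := u)
        (fun j hj => by simpa using hul j (by simpa [Nat.lt_succ_iff] using hj))
      simp only [mem_range, Nat.lt_succ_iff] at hx hy
      have := (hut x hx).symm.trans ((congrArg t huxy).trans (hut y hy))
      exact hxy (Nat.pair_eq_pair.1 this).2
    have hdvd := dvd_of_linearCombination_mem hF hfF hind hfN hfl (Nat.left_le_pair l j)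
    rw [Finsupp.add_apply, hdj, add_zero, blockCoeff_apply] at hdvd
    simp only [Nat.unpair_pair, hjl, if_true] at hdvd
    exact hl.2 hdvd
  have hhc : Finsupp.linearCombination ℤ h c = 0 := by
    rw [Finsupp.linearCombination_apply]
    exact sum_eq_zero fun j _ => smul_eq_zero_of_natCast_dvd (hhN j) (hcN j)
  rw [hhc, zero_add] at hgcd
  have hfa (i : ℕ) (hi : m ≤ i) :=
    dvd_of_linearCombination_mem hF hfF hind hfN (hgcd ▸ hg) hi
  refine hg0 (hgcd.trans ?_)
  rw [Finsupp.linearCombination_apply]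
  refine sum_eq_zero fun i hi => ?_
  -- Indices below `m` do not occur: blocks from `m` on use codes at least `m`, and each `t j`
  -- exceeds `m`.
  rcases le_or_gt m i with hmi | hmi
  · exact smul_eq_zero_of_natCast_dvd (hfN i) (hfa i hmi)
  · have h1 : c i.unpair.1 = 0 := by
      by_contra hne
      exact absurd ((hc' _ hne).trans (Nat.unpair_left_le i)) (not_le.2 hmi)
    have h2 : d i = 0 := by
      by_contra hne
      obtain ⟨j, -, rfl⟩ := hd i hne
      have := ht j
      omega
    exact absurd (by simp [blockCoeff_apply, h1, h2]) (Finsupp.mem_support_iff.1 hi)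

theorem notMem_sumNhd_blockSequence_of_notMem {Y : AddSubgroup G} (hf : ∀ n, f n ∈ Y)
    (hh : ∀ n, h n ∈ Y) {g : G} (hg : g ∉ Y) (s : ℕ → ℕ) :
    g ∉ (blockSequence f h).sumNhd s := by
  intro hmem
  obtain ⟨k, hk⟩ := Set.mem_iUnion.1 hmem
  obtain ⟨c, d, t, -, -, -, rfl⟩ := exists_linearCombination_of_mem_partialSums hk
  refine hg (add_mem ?_ ?_) <;> rw [Finsupp.linearCombination_apply] <;>
    refine sum_mem fun j _ => AddSubgroup.zsmul_mem _ ?_ _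
  · exact add_mem (hh j) (sum_mem fun i _ => hf _)
  · exact hf j

/-! ### Continuous characters of the block topology -/

theorem addChar_sum_eq_one {ι : Type*} {s : Finset ι} {u : ι → G} {χ : AddChar G Circle}
    (hu : ∀ i ∈ s, χ (u i) = 1) : χ (∑ i ∈ s, u i) = 1 :=
  χ.toAddMonoidHom.ker.sum_mem hu

/-- Since `Nat.pair n j ≥ n`, the character is `1` on all terms from index `l` on, hence on a whole
neighbourhood of `0`. -/
theorem continuous_addChar_blockSequence {χ : AddChar G Circle} (hh : ∀ n, χ (h n) = 1) {l : ℕ}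
    (hf : ∀ n, l ≤ n → χ (f n) = 1) :
    @Continuous G Circle (blockSequence f h).topology _ χ := by
  let := (blockSequence f h).topology
  have := (blockSequence f h).isTopologicalAddGroup
  have hv (n : ℕ) (hn : l ≤ n) : χ (blockTerm f h n) = 1 := by
    have (j : ℕ) : χ (f (Nat.pair n j)) = 1 := hf _ (hn.trans (Nat.left_le_pair n j))
    rw [blockTerm, AddChar.map_add_eq_mul, hh, addChar_sum_eq_one fun j _ => this j, one_mul]
  have htail (x : G) (hx : x ∈ (blockSequence f h).tail l) : χ x = 1 := by
    rcases mem_tail_blockSequence.1 hx with rfl | ⟨n, hn, rfl | rfl | rfl | rfl⟩ <;>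
      simp [AddChar.map_neg_eq_inv, *]
  have hps (k : ℕ) (x : G) (hx : x ∈ (blockSequence f h).partialSums (fun _ => l) k) : χ x = 1 := by
    induction k generalizing x with
    | zero =>
      rw [NullSequence.partialSums_zero, Set.mem_zero] at hx
      simp [hx]
    | succ k ih =>
      rw [NullSequence.partialSums_succ] at hx
      obtain ⟨y, hy, z, hz, rfl⟩ := hx
      rw [AddChar.map_add_eq_mul, ih y hy, htail z hz, one_mul]
  have h0 : ContinuousAt χ.toAddMonoidHom 0 := by
    have : χ.toAddMonoidHom =ᶠ[𝓝 0] fun _ => 0 := by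
      filter_upwards [NullSequence.nhds_zero_hasBasis.mem_of_mem (i := fun _ => l) trivial]
        with x hx
      obtain ⟨k, hk⟩ := Set.mem_iUnion.1 hx
      exact hps k x hk
    exact continuousAt_const.congr this.symm
  exact continuous_of_continuousAt_zero χ.toAddMonoidHom h0

theorem Circle.finite_setOf_pow_eq_one {N : ℕ} (hN : N ≠ 0) : {w : Circle | w ^ N = 1}.Finite := by
  refine ((Polynomial.nthRootsFinset N (1 : ℂ)).finite_toSet.preimage
    Circle.coe_injective.injOn).subset fun (w : Circle) hw => ?_
  have hw' : (w : ℂ) ^ N = 1 := by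
    rw [← Circle.coe_pow, show w ^ N = 1 from hw, Circle.coe_one]
  exact (Polynomial.mem_nthRootsFinset (Nat.pos_of_ne_zero hN) _).2 hw'

/-- There are finitely many `N`-th roots of unity, so `1` is isolated among them. -/
theorem Circle.eventually_eq_one_of_tendsto {N : ℕ} (hN : N ≠ 0) {z : ℕ → Circle}
    (hz : ∀ n, z n ^ N = 1) (hlim : Tendsto z atTop (𝓝 1)) : ∀ᶠ n in atTop, z n = 1 := by
  have hopen : IsOpen ({w : Circle | w ^ N = 1} \ {1})ᶜ :=
    ((Circle.finite_setOf_pow_eq_one hN).subset Set.sdiff_subset).isClosed.isOpen_compl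
  filter_upwards [hlim (hopen.mem_nhds (by simp))] with n hn
  by_contra hne
  exact hn ⟨hz n, hne⟩

theorem addChar_eq_one_of_continuous_blockSequence (hN : N ≠ 0) (hfN : ∀ n, N • f n = 0)
    (hhN : ∀ n, N • h n = 0) {χ : AddChar G Circle}
    (hχ : @Continuous G Circle (blockSequence f h).topology _ χ) :
    ∀ᶠ n in atTop, χ (h n) = 1 := by
  let := (blockSequence f h).topology
  have := (blockSequence f h).isTopologicalAddGroup
  have hlim (u : ℕ → G) (hu : ∀ n, u n = f n ∨ u n = blockTerm f h n) :
      Tendsto (fun n => χ (u n)) atTop (𝓝 1) := by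
    have h0 : Tendsto u atTop (𝓝 0) := by
      refine NullSequence.nhds_zero_hasBasis.tendsto_right_iff.2 fun s _ => ?_
      filter_upwards [eventually_ge_atTop (s 0)] with n hn
      refine NullSequence.tail_subset_sumNhd s (mem_tail_blockSequence.2 (Or.inr ⟨n, hn, ?_⟩))
      rcases hu n with h | h <;> simp [h]
    simpa [Function.comp_def] using (hχ.tendsto 0).comp h0
  have hvN (n : ℕ) : N • blockTerm f h n = 0 := by
    simp [blockTerm, smul_add, Finset.smul_sum, hfN, hhN]
  have hpow {x : G} (hx : N • x = 0) : χ x ^ N = 1 := by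
    rw [← AddChar.map_nsmul_eq_pow, hx, AddChar.map_zero_eq_one]
  have h1 := Circle.eventually_eq_one_of_tendsto hN (fun n => hpow (hfN n))
    (hlim f fun n => Or.inl rfl)
  have h2 := Circle.eventually_eq_one_of_tendsto hN (fun n => hpow (hvN n))
    (hlim (blockTerm f h) fun n => Or.inr rfl)
  obtain ⟨l, hl⟩ := eventually_atTop.1 h1
  filter_upwards [h2, eventually_ge_atTop l] with n hn hln
  have (j : ℕ) : χ (f (Nat.pair n j)) = 1 := hl _ (hln.trans (Nat.left_le_pair n j))
  rwa [blockTerm, AddChar.map_add_eq_mul, addChar_sum_eq_one fun j _ => this j, mul_one] at hn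

end BlockSequence

/-! ### Subgroups `Z(N)^(ω)` in bounded groups -/

section OmegaSum

variable {G : Type*} [AddCommGroup G]

theorem ContainsOmegaSum.exists_injective {N : ℕ} (h : ContainsOmegaSum G N) :
    ∃ φ : (ℕ →₀ ZMod N) →+ G, Function.Injective φ := by
  obtain ⟨K, ⟨e⟩⟩ := h
  exact ⟨K.subtype.comp e.symm.toAddMonoidHom, K.subtype_injective.comp e.symm.injective⟩

theorem map_mapRange_intCast {N : ℕ} (φ : (ℕ →₀ ZMod N) →+ G) (c : ℕ →₀ ℤ) :
    φ (c.mapRange (Int.cast : ℤ → ZMod N) Int.cast_zero) =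
      Finsupp.linearCombination ℤ (fun i => φ (Finsupp.single i 1)) c := by
  induction c using Finsupp.induction_linear with
  | zero => simp
  | add c d hc hd => rw [Finsupp.mapRange_add (by simp), map_add, hc, hd, map_add]
  | single n z =>
    rw [Finsupp.mapRange_single, Finsupp.linearCombination_single, ← map_zsmul,
      Finsupp.smul_single, zsmul_one]

/-- `G` contains `Z(N)^(ω)` iff it contains an independent sequence of elements of order `N`. -/
theorem containsOmegaSum_iff {N : ℕ} : ContainsOmegaSum G N ↔
    ∃ g : ℕ → G, (∀ i, N • g i = 0) ∧
      ∀ c : ℕ →₀ ℤ, Finsupp.linearCombination ℤ g c = 0 → ∀ i, (N : ℤ) ∣ c i := by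
  constructor
  · intro h
    obtain ⟨φ, hφ⟩ := h.exists_injective
    refine ⟨fun i => φ (Finsupp.single i 1), fun i => ?_, fun c hc i => ?_⟩
    · rw [← map_nsmul, Finsupp.smul_single]
      simp
    · rw [← map_mapRange_intCast, map_eq_zero_iff φ hφ] at hc
      have := DFunLike.congr_fun hc i
      rw [Finsupp.mapRange_apply, Finsupp.zero_apply] at this
      exact (ZMod.intCast_zmod_eq_zero_iff_dvd _ _).1 this
  · rintro ⟨g, hg, hind⟩
    let φ : (ℕ →₀ ZMod N) →+ G := Finsupp.liftAddHom fun i =>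
      ZMod.lift N ⟨zmultiplesHom G (g i), by simpa using hg i⟩
    have hφ1 : (fun i => φ (Finsupp.single i 1)) = g := by
      funext i
      have := ZMod.lift_coe N ⟨zmultiplesHom G (g i), by simpa using hg i⟩ 1
      simpa [φ] using this
    have hφ : Function.Injective φ := by
      rw [injective_iff_map_eq_zero]
      intro x hx
      have hx' : (x.mapRange (ZMod.cast : ZMod N → ℤ) ZMod.cast_zero).mapRange
          (Int.cast : ℤ → ZMod N) Int.cast_zero = x := by
        ext i
        simp
      rw [← hx', map_mapRange_intCast, hφ1] at hx
      rw [← hx']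
      ext i
      rw [Finsupp.mapRange_apply, Finsupp.zero_apply]
      exact (ZMod.intCast_zmod_eq_zero_iff_dvd _ _).2 (hind _ hx i)
    exact ⟨φ.range, ⟨(AddMonoidHom.ofInjective hφ).symm⟩⟩

theorem containsOmegaSum_one : ContainsOmegaSum G 1 :=
  containsOmegaSum_iff.2 ⟨0, by simp, fun _ _ _ => by simp⟩

theorem linearCombination_smul_family (n : ℤ) (g : ℕ → G) (c : ℕ →₀ ℤ) :
    Finsupp.linearCombination ℤ (fun i => n • g i) c = n • Finsupp.linearCombination ℤ g c := by
  simp only [Finsupp.linearCombination_apply, Finsupp.sum, smul_sum]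
  exact sum_congr rfl fun i _ => smul_comm _ _ _

/-- For the family `g i + h i`, multiplying a relation by `b` removes the `h`-part and by `a` the
`g`-part. -/
theorem ContainsOmegaSum.mul {a b : ℕ} (hab : a.Coprime b) (ha : ContainsOmegaSum G a)
    (hb : ContainsOmegaSum G b) : ContainsOmegaSum G (a * b) := by
  obtain ⟨g, hg, hgi⟩ := containsOmegaSum_iff.1 ha
  obtain ⟨h, hh, hhi⟩ := containsOmegaSum_iff.1 hb
  have hadd (c : ℕ →₀ ℤ) : Finsupp.linearCombination ℤ (fun i => g i + h i) c =
      Finsupp.linearCombination ℤ g c + Finsupp.linearCombination ℤ h c := by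
    simp [Finsupp.linearCombination_apply, Finsupp.sum, sum_add_distrib]
  have hkill {n : ℕ} {u : ℕ → G} (hu : ∀ i, n • u i = 0) (c : ℕ →₀ ℤ) :
      Finsupp.linearCombination ℤ u ((n : ℤ) • c) = 0 := by
    rw [map_smul, ← linearCombination_smul_family]
    simp [Finsupp.linearCombination_apply, hu]
  have hcop : IsCoprime (a : ℤ) b := Nat.isCoprime_iff_coprime.2 hab
  refine containsOmegaSum_iff.2 ⟨fun i => g i + h i, fun i => ?_, fun c hc i => ?_⟩
  · rw [smul_add, mul_comm, mul_smul, hg, mul_comm, mul_smul, hh]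
    simp
  · rw [hadd] at hc
    rw [Nat.cast_mul]
    refine hcop.mul_dvd ?_ ?_
    · have h1 := congrArg (fun x => (b : ℤ) • x) hc
      simp only [smul_add, ← map_smul, hkill hh, add_zero, smul_zero] at h1
      exact hcop.dvd_of_dvd_mul_left (by simpa using hgi _ h1 i)
    · have h1 := congrArg (fun x => (a : ℤ) • x) hc
      simp only [smul_add, ← map_smul, hkill hg, zero_add, smul_zero] at h1
      exact hcop.symm.dvd_of_dvd_mul_left (by simpa using hhi _ h1 i)

theorem containsOmegaSum_of_prime_pow {N : ℕ} (hN : N ≠ 0)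
    (h : ∀ p k : ℕ, p.Prime → p ^ (k + 1) ∣ N → ContainsOmegaSum G (p ^ (k + 1))) :
    ContainsOmegaSum G N := by
  induction N using Nat.recOnPosPrimePosCoprime with
  | zero => exact absurd rfl hN
  | one => exact containsOmegaSum_one
  | prime_pow p n hp hn =>
    obtain ⟨k, rfl⟩ := Nat.exists_eq_succ_of_ne_zero hn.ne'
    exact h p k hp dvd_rfl
  | coprime a b ha hb hab iha ihb =>
    exact (iha (by omega) fun p k hp hk => h p k hp (hk.mul_right b)).mul hab
      (ihb (by omega) fun p k hp hk => h p k hp (hk.mul_left a))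

/-- An infinite `𝔽_p`-vector space contains an infinite independent sequence. -/
theorem exists_independent_of_infinite (p : ℕ) [Fact p.Prime] (T : Type*) [AddCommGroup T]
    [Module (ZMod p) T] [Infinite T] :
    ∃ b : ℕ → T, ∀ c : ℕ →₀ ℤ, Finsupp.linearCombination ℤ b c = 0 → ∀ i, (p : ℤ) ∣ c i := by
  let B := Module.Basis.ofVectorSpace (ZMod p) T
  have hinf : Infinite (Module.Basis.ofVectorSpaceIndex (ZMod p) T) := by
    by_contra hfin
    rw [not_infinite_iff_finite] at hfin
    have : Finite T := Finite.of_equiv _ B.equivFun.toEquiv.symm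
    exact not_finite T
  let e := Infinite.natEmbedding (Module.Basis.ofVectorSpaceIndex (ZMod p) T)
  obtain ⟨b, hli⟩ : ∃ b : ℕ → T, LinearIndependent (ZMod p) b :=
    ⟨_, B.linearIndependent.comp e e.injective⟩
  refine ⟨b, fun c hc i => ?_⟩
  have hcast : Finsupp.linearCombination (ZMod p) b
      (c.mapRange (Int.cast : ℤ → ZMod p) Int.cast_zero) =
        Finsupp.linearCombination ℤ b c := by
    rw [Finsupp.linearCombination_apply, Finsupp.linearCombination_apply,
      Finsupp.sum_mapRange_index (by simp)]
    simp [Int.cast_smul_eq_zsmul]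
  have h0 := linearIndependent_iff.1 hli _ (hcast.trans hc)
  have := DFunLike.congr_fun h0 i
  rw [Finsupp.mapRange_apply, Finsupp.zero_apply] at this
  exact (ZMod.intCast_zmod_eq_zero_iff_dvd _ _).1 this

/-- The set is an infinite `𝔽_p`-space; `p ^ k`-th roots of an independent sequence in it are
independent of order `p ^ (k + 1)`. -/
theorem containsOmegaSum_of_infinite_torsion {p : ℕ} (hp : p.Prime) (k : ℕ)
    (hinf : {x : G | p • x = 0 ∧ ∃ y, p ^ k • y = x}.Infinite) :
    ContainsOmegaSum G (p ^ (k + 1)) := by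
  let T : AddSubgroup G := (nsmulAddMonoidHom p).ker ⊓ (nsmulAddMonoidHom (p ^ k)).range
  have : Infinite T := hinf.to_subtype
  have : Fact p.Prime := ⟨hp⟩
  let : Module (ZMod p) T := AddCommGroup.zmodModule fun x => Subtype.ext x.2.1
  obtain ⟨b, hb⟩ := exists_independent_of_infinite p T
  choose g hg using fun i => (b i).2.2
  have hg' (i : ℕ) : ((p : ℤ) ^ k) • g i = b i := by
    rw [← hg]
    simp [← natCast_zsmul]
  refine containsOmegaSum_iff.2 ⟨g, fun i => ?_, fun c hc i => ?_⟩
  · have h1 : p • ((b i : T) : G) = 0 := (b i).2.1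
    rw [pow_succ', mul_smul]
    rw [← hg] at h1
    exact h1
  -- If `c = p ^ j • c'`, multiplying the relation by `p ^ (k - j)` gives `∑ c' i • b i = 0`, which
  -- yields one more factor `p`.
  · have key : ∀ j ≤ k + 1, ∀ i, (p : ℤ) ^ j ∣ c i := by
      intro j
      induction j with
      | zero => simp
      | succ j ih =>
        intro hj i
        choose d hd using ih (by omega)
        have hp0 : (p : ℤ) ^ j ≠ 0 := pow_ne_zero _ (by exact_mod_cast hp.ne_zero)
        let c' : ℕ →₀ ℤ := c.mapRange (· / (p : ℤ) ^ j) (by simp)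
        have hcc : c = (p : ℤ) ^ j • c' := by
          ext i
          simp [c', hd, Int.mul_ediv_cancel_left _ hp0]
        have h0 : Finsupp.linearCombination ℤ b c' = 0 := by
          have hcoe : ((Finsupp.linearCombination ℤ b c' : T) : G) =
              Finsupp.linearCombination ℤ (fun i => ((p : ℤ) ^ k) • g i) c' := by
            simp [Finsupp.linearCombination_apply, Finsupp.sum, hg']
          have hz : (p : ℤ) ^ k • Finsupp.linearCombination ℤ g c' = 0 := by
            rw [show k = (k - j) + j by omega, pow_add, mul_smul, ← map_smul, ← hcc, hc, smul_zero]
          exact Subtype.ext (by rw [hcoe, linearCombination_smul_family, hz]; rfl)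
        have := hb c' h0 i
        rw [hcc, Finsupp.smul_apply, smul_eq_mul, pow_succ]
        exact mul_dvd_mul_left _ this
    exact_mod_cast key (k + 1) le_rfl i

/-- Either `pB` is infinite and has a smaller exponent bound, or `B → pB` has finite image and
therefore infinite kernel. -/
theorem exists_prime_infinite_torsion {m : ℕ} (hm : m ≠ 0) (B : AddSubgroup G)
    (hB : (B : Set G).Infinite) (hmB : ∀ x ∈ B, m • x = 0) :
    ∃ p : ℕ, p.Prime ∧ p ∣ m ∧ {x ∈ (B : Set G) | p • x = 0}.Infinite := by
  induction m using induction_on_primes generalizing B with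
  | zero => exact absurd rfl hm
  | one =>
    refine absurd ?_ hB
    exact (Set.finite_singleton 0).subset fun x hx => by simpa using hmB x hx
  | prime_mul p a hp ih =>
    by_cases hinf : ((B.map (nsmulAddMonoidHom p) : AddSubgroup G) : Set G).Infinite
    · obtain ⟨q, hq, hqa, hqi⟩ := ih (by rintro rfl; simp at hm) _ hinf (by
        rintro _ ⟨x, hx, rfl⟩
        have := hmB x hx
        rwa [mul_comm, mul_smul] at this)
      refine ⟨q, hq, hqa.mul_left p, hqi.mono ?_⟩
      rintro _ ⟨⟨x, hx, rfl⟩, hqx⟩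
      exact ⟨AddSubgroup.nsmul_mem _ hx p, hqx⟩
    · refine ⟨p, hp, dvd_mul_right p a, fun hfin => hB ?_⟩
      refine Set.Finite.of_finite_fibers (fun x => p • x) (Set.not_infinite.1 hinf) ?_
      rintro _ ⟨y, hy, rfl⟩
      refine (hfin.image (y + ·)).subset ?_
      rintro x ⟨hx, hxy⟩
      refine ⟨x - y, ⟨sub_mem hx hy, ?_⟩, by simp⟩
      have hxy' : p • x = p • y := hxy
      rw [smul_sub, hxy', sub_self]

end OmegaSum

/-! ### Necessity -/

section Radical

variable {G : Type*} [AddCommGroup G]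

/-- Characters to `ℚ/ℤ` separate the points of `G ⧸ S`, and `ℚ/ℤ` embeds in the circle through
`ℝ/ℤ`. -/
theorem exists_addChar_ne_one {S : AddSubgroup G} {x : G} (hx : x ∉ S) :
    ∃ χ : AddChar G Circle, (∀ y ∈ S, χ y = 1) ∧ χ x ≠ 1 := by
  have hx' : (x : G ⧸ S) ≠ 0 := fun h => hx ((QuotientAddGroup.eq_zero_iff x).1 h)
  obtain ⟨c, hc⟩ := CharacterModule.exists_character_apply_ne_zero_of_ne_zero hx'
  have hle : AddSubgroup.zmultiples (1 : ℚ) ≤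
      (AddSubgroup.zmultiples (1 : ℝ)).comap (Rat.castHom ℝ).toAddMonoidHom := by
    rw [AddSubgroup.zmultiples_le]
    exact ⟨1, by simp⟩
  let r : AddCircle (1 : ℚ) →+ AddCircle (1 : ℝ) := QuotientAddGroup.map _ _ _ hle
  have hr (a : AddCircle (1 : ℚ)) (ha : r a = 0) : a = 0 := by
    induction a using QuotientAddGroup.induction_on with
    | H q =>
      have hq : ((q : ℝ) : AddCircle (1 : ℝ)) = 0 := ha
      obtain ⟨n, hn⟩ := (AddCircle.coe_eq_zero_iff (1 : ℝ)).1 hq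
      refine (AddCircle.coe_eq_zero_iff (1 : ℚ)).2 ⟨n, ?_⟩
      simp only [zsmul_one] at hn ⊢
      exact_mod_cast hn
  let ψ : AddChar (AddCircle (1 : ℝ)) Circle :=
    { toFun := AddCircle.toCircle
      map_zero_eq_one' := AddCircle.toCircle_zero
      map_add_eq_mul' := AddCircle.toCircle_add }
  let c' : G ⧸ S →+ AddCircle (1 : ℚ) := c
  refine ⟨ψ.compAddMonoidHom ((r.comp c').comp (QuotientAddGroup.mk' S)), fun y hy => ?_,
    fun h => hc (hr _ ?_)⟩
  · have : (y : G ⧸ S) = 0 := (QuotientAddGroup.eq_zero_iff y).2 hy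
    simp [this]
  · refine AddCircle.injective_toCircle one_ne_zero ?_
    rw [AddCircle.toCircle_zero]
    exact h

theorem nsmul_eq_zero_of_mem_vonNeumannRadical [TopologicalSpace G] [IsTopologicalAddGroup G]
    [T2Space G] {n : ℕ} (hn : (Set.range fun x : G => n • x).Finite) {x : G}
    (hx : x ∈ vonNeumannRadical G) : n • x = 0 := by
  by_contra hne
  let ψ : G →+ G := nsmulAddMonoidHom n
  have : Finite ψ.range := hn.to_subtype
  have hcont : Continuous ψ.rangeRestrict := (continuous_nsmul n).subtype_mk _
  obtain ⟨χ, -, hχ⟩ := exists_addChar_ne_one (S := (⊥ : AddSubgroup ψ.range))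
    (x := ψ.rangeRestrict x) fun h => hne (congrArg Subtype.val (AddSubgroup.mem_bot.1 h))
  refine hχ (mem_vonNeumannRadical.1 hx (χ.compAddMonoidHom ψ.rangeRestrict) ?_)
  exact (continuous_of_discreteTopology (f := χ)).comp hcont

theorem containsOmegaSum_of_mem_NR (hG : AddMonoid.ExponentExists G) {H : AddSubgroup G}
    (hH : H ∈ NR G) : ContainsOmegaSum G (AddMonoid.exponent H) := by
  obtain ⟨_, _, _, -, hrad⟩ := hH
  set m := AddMonoid.exponent G with hm
  have hm0 : m ≠ 0 := AddMonoid.exponent_ne_zero.2 hG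
  have hexp : AddMonoid.exponent H ∣ m :=
    AddMonoid.exponent_dvd_of_forall_nsmul_eq_zero fun x =>
      Subtype.ext (AddMonoid.exponent_nsmul_eq_zero (x : G))
  refine containsOmegaSum_of_prime_pow (ne_zero_of_dvd_ne_zero hm0 hexp) fun p k hp hk => ?_
  obtain ⟨a, m', hpm', hmm⟩ := Nat.exists_eq_pow_mul_and_not_dvd hm0 p hp.ne_one
  have hinf : (Set.range fun x : G => (p ^ k * m') • x).Infinite := by
    intro hfin
    have hdvd : AddMonoid.exponent H ∣ p ^ k * m' :=
      AddMonoid.exponent_dvd_of_forall_nsmul_eq_zero fun x =>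
        Subtype.ext (nsmul_eq_zero_of_mem_vonNeumannRadical hfin (hrad ▸ x.2))
    have := hk.trans hdvd
    rw [pow_succ] at this
    exact hpm' (Nat.dvd_of_mul_dvd_mul_left (pow_pos hp.pos k) this)
  obtain ⟨q, hq, hqp, hqi⟩ := exists_prime_infinite_torsion (pow_ne_zero a hp.ne_zero)
    (nsmulAddMonoidHom (p ^ k * m') : G →+ G).range hinf (by
      rintro _ ⟨x, rfl⟩
      change p ^ a • (p ^ k * m') • x = 0
      rw [← mul_smul, show p ^ a * (p ^ k * m') = p ^ k * m by rw [hmm]; ring, mul_smul,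
        AddMonoid.exponent_nsmul_eq_zero, smul_zero])
  obtain rfl := (Nat.prime_dvd_prime_iff_eq hq hp).1 (hq.dvd_of_dvd_pow hqp)
  refine containsOmegaSum_of_infinite_torsion hp k (hqi.mono ?_)
  rintro _ ⟨⟨x, rfl⟩, hx⟩
  exact ⟨hx, m' • x, (mul_smul _ _ _).symm⟩

end Radical

/-! ### Sufficiency: choice of `f` and the resulting topology -/

section Construction

variable {G : Type*} [AddCommGroup G]

theorem finite_closure_finset (hG : AddMonoid.ExponentExists G) (S : Finset G) :
    (AddSubgroup.closure (S : Set G) : Set G).Finite := by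
  have : AddGroup.FG (AddSubgroup.closure (S : Set G)) :=
    (AddGroup.fg_iff_addSubgroup_fg _).2 ⟨S, rfl⟩
  refine Set.finite_coe_iff.1 (AddCommGroup.finite_of_fg_isAddTorsion _ fun x => ?_)
  obtain ⟨m, hm, h⟩ := hG
  exact isOfFinAddOrder_iff_nsmul_eq_zero.2 ⟨m, hm, Subtype.ext (h x)⟩

/-- Given a copy of `Z(N)^(ω)`, a finite subgroup and finitely many characters, there is an
element of order `N` which is independent of the subgroup and killed by the characters. -/
theorem exists_fresh {N : ℕ} (hN : N ≠ 0) {φ : (ℕ →₀ ZMod N) →+ G} (hφ : Function.Injective φ)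
    (χ : ℕ → AddChar G Circle) (n : ℕ) {F : AddSubgroup G} (hF : (F : Set G).Finite) :
    ∃ x ∈ φ.range, (∀ l < n, χ l x = 1) ∧ ∀ d : ℤ, d • x ∈ F → (N : ℤ) ∣ d := by
  have hfin : {v : ℕ →₀ ZMod N | φ v ∈ F}.Finite := hF.preimage hφ.injOn
  obtain ⟨M, hM⟩ : ∃ M, ∀ v, φ v ∈ F → ∀ i, M ≤ i → v i = 0 := by
    refine ⟨hfin.toFinset.sup (fun v => v.support.sup id + 1), fun v hv i hi => ?_⟩
    by_contra hne
    have h1 : i ≤ v.support.sup id := Finset.le_sup (f := id) (Finsupp.mem_support_iff.2 hne)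
    have h2 : v.support.sup id + 1 ≤ hfin.toFinset.sup (fun v => v.support.sup id + 1) :=
      Finset.le_sup (f := fun v : ℕ →₀ ZMod N => v.support.sup id + 1)
        (hfin.mem_toFinset.2 hv)
    omega
  have hroot (l i : ℕ) : χ l (φ (Finsupp.single i 1)) ^ N = 1 := by
    rw [← AddChar.map_nsmul_eq_pow, ← map_nsmul, Finsupp.smul_single]
    simp
  have := (Circle.finite_setOf_pow_eq_one hN).to_subtype
  -- On generators beyond all supports meeting `F`, the `n` characters take finitely many value
  -- tuples; two generators agree, and their difference is killed.
  obtain ⟨i, j, hij, heq⟩ := Finite.exists_ne_map_eq_of_infinite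
    fun i (l : Fin n) =>
      (⟨χ l (φ (Finsupp.single (M + i) 1)), hroot _ _⟩ : {w : Circle | w ^ N = 1})
  refine ⟨φ (Finsupp.single (M + i) 1 - Finsupp.single (M + j) 1), ⟨_, rfl⟩, fun l hl => ?_,
    fun d hd => ?_⟩
  · have := congrArg Subtype.val (congrFun heq ⟨l, hl⟩)
    simp only at this
    rw [map_sub, AddChar.map_sub_eq_div, this, div_self']
  · rw [← map_zsmul] at hd
    have h0 := hM _ hd (M + i) (Nat.le_add_right M i)
    rw [Finsupp.smul_apply, Finsupp.sub_apply, Finsupp.single_eq_same,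
      Finsupp.single_eq_of_ne (by omega), sub_zero, zsmul_one] at h0
    exact (ZMod.intCast_zmod_eq_zero_iff_dvd _ _).1 h0

theorem exists_fresh_sequence (hG : AddMonoid.ExponentExists G) {N : ℕ} (hN : N ≠ 0)
    {φ : (ℕ →₀ ZMod N) →+ G} (hφ : Function.Injective φ) (χ : ℕ → AddChar G Circle)
    (y h : ℕ → G) :
    ∃ (f : ℕ → G) (F : ℕ → AddSubgroup G), Monotone F ∧ (∀ n, f n ∈ φ.range) ∧
      (∀ n, f n ∈ F (n + 1)) ∧ (∀ n, y n ∈ F n) ∧ (∀ n, h n ∈ F n) ∧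
      (∀ n, ∀ l < n, χ l (f n) = 1) ∧ ∀ n, ∀ d : ℤ, d • f n ∈ F n → (N : ℤ) ∣ d := by
  classical
  choose X hXφ hXχ hXF using fun (n : ℕ) (S : Finset G) =>
    exists_fresh hN hφ χ n (finite_closure_finset hG S)
  -- `F n` is generated by `y i`, `h i` for `i ≤ n` and `f i` for `i < n`; it is finite because `G`
  -- is bounded.
  obtain ⟨S, hS0, hS⟩ : ∃ S : ℕ → Finset G, S 0 = {y 0, h 0} ∧
      ∀ n, S (n + 1) = S n ∪ {X n (S n), y (n + 1), h (n + 1)} :=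
    ⟨fun n => Nat.rec {y 0, h 0} (fun n S => S ∪ {X n S, y (n + 1), h (n + 1)}) n, rfl,
      fun _ => rfl⟩
  have hyh (n : ℕ) : y n ∈ S n ∧ h n ∈ S n := by
    cases n with
    | zero => simp [hS0]
    | succ n => simp [hS]
  refine ⟨fun n => X n (S n), fun n => AddSubgroup.closure (S n : Set G),
    monotone_nat_of_le_succ fun n => AddSubgroup.closure_mono ?_, fun n => hXφ _ _,
    fun n => AddSubgroup.subset_closure ?_, fun n => AddSubgroup.subset_closure (hyh n).1,
    fun n => AddSubgroup.subset_closure (hyh n).2, fun n => hXχ _ _, fun n => hXF _ _⟩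
  · rw [hS, coe_union]
    exact Set.subset_union_left
  · rw [mem_coe, hS]
    simp

theorem mem_NRC_of_injective (hG : AddMonoid.ExponentExists G) {H : AddSubgroup G}
    (hH : (H : Set G).Countable) {N : ℕ} (hN : 2 ≤ N) (hHN : ∀ x ∈ H, N • x = 0)
    {φ : (ℕ →₀ ZMod N) →+ G} (hφ : Function.Injective φ) : H ∈ NRC G := by
  have hN0 : N ≠ 0 := by omega
  have : NeZero N := ⟨hN0⟩
  set Y : AddSubgroup G := H ⊔ φ.range with hYdef
  have hYc : (Y : Set G).Countable := by
    rw [hYdef, AddSubgroup.add_normal]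
    exact hH.image2 (Set.countable_range φ) (· + ·)
  have := hH.to_subtype
  have := hYc.to_subtype
  obtain ⟨q, hq⟩ := exists_surjective_nat H
  obtain ⟨y, hy⟩ := exists_surjective_nat Y
  -- Unpairing makes every element of `H` occur infinitely often.
  set h : ℕ → G := fun n => q n.unpair.1 with hh
  have hhH (n : ℕ) : h n ∈ H := (q _).2
  have hchar (l : ℕ) : ∃ χ : AddChar G Circle, (∀ x ∈ H, χ x = 1) ∧
      ((y l : G) ∉ H → χ (y l) ≠ 1) := by
    by_cases hl : (y l : G) ∈ H
    · exact ⟨1, by simp, fun h => absurd hl h⟩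
    · obtain ⟨χ, h1, h2⟩ := exists_addChar_ne_one hl
      exact ⟨χ, h1, fun _ => h2⟩
  choose χ hχH hχy using hchar
  obtain ⟨f, F, hF, hfφ, hfF, hyF, hhF, hfχ, hind⟩ :=
    exists_fresh_sequence hG hN0 hφ χ (fun n => y n) h
  have hfN (n : ℕ) : N • f n = 0 := by
    obtain ⟨v, hv⟩ := hfφ n
    rw [← hv, ← map_nsmul]
    have : N • v = 0 := by
      ext i
      simp
    rw [this, map_zero]
  have hhN (n : ℕ) : N • h n = 0 := hHN _ (hhH n)
  have hfY (n : ℕ) : f n ∈ Y := le_sup_right (a := H) (hfφ n)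
  have hhY (n : ℕ) : h n ∈ Y := le_sup_left (b := φ.range) (hhH n)
  let := (blockSequence f h).topology
  have hgrp := (blockSequence f h).isTopologicalAddGroup
  have hnhd (s : ℕ → ℕ) : (blockSequence f h).sumNhd s ∈ 𝓝 (0 : G) :=
    NullSequence.nhds_zero_hasBasis.mem_of_mem trivial
  refine ⟨_, hgrp, ?_, NullSequence.completeSpace, ?_, ?_⟩
  · refine IsTopologicalAddGroup.t2Space_of_zero_sep fun x hx => ?_
    by_cases hxY : x ∈ Y
    · obtain ⟨m, hm⟩ := hy ⟨x, hxY⟩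
      have hxF : x ∈ F m := by simpa [hm] using hyF m
      exact ⟨_, hnhd _, notMem_sumNhd_blockSequence hF hfF hhF hind hfN hhN hxF hx⟩
    · exact ⟨_, hnhd 0, notMem_sumNhd_blockSequence_of_notMem hfY hhY hxY 0⟩
  · intro hdisc
    obtain ⟨s, -, hs⟩ := NullSequence.nhds_zero_hasBasis.mem_iff.1
      ((isOpen_discrete {(0 : G)}).mem_nhds rfl)
    have h0 : f (s 0) = 0 := hs (NullSequence.tail_subset_sumNhd s
      (mem_tail_blockSequence.2 (Or.inr ⟨s 0, le_rfl, Or.inl rfl⟩)))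
    have := hind (s 0) 1 (by rw [h0, smul_zero]; exact zero_mem _)
    have := Int.le_of_dvd one_pos this
    omega
  · ext x
    rw [mem_vonNeumannRadical]
    constructor
    · intro hx
      by_contra hxH
      by_cases hxY : x ∈ Y
      · obtain ⟨l, hl⟩ := hy ⟨x, hxY⟩
        have hl' : (y l : G) = x := by rw [hl]
        refine hχy l (by rwa [hl']) ?_
        rw [hl']
        exact hx (χ l) (continuous_addChar_blockSequence (l := l + 1)
          (fun n => hχH l _ (hhH n)) fun n hn => hfχ n l hn)
      · obtain ⟨ψ, hψ, hψx⟩ := exists_addChar_ne_one hxY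
        exact hψx (hx ψ (continuous_addChar_blockSequence (l := 0) (fun n => hψ _ (hhY n))
          fun n _ => hψ _ (hfY n)))
    · intro hx ψ hψ
      obtain ⟨k, hk⟩ := hq ⟨x, hx⟩
      obtain ⟨l, hl⟩ := eventually_atTop.1
        (addChar_eq_one_of_continuous_blockSequence hN0 hfN hhN hψ)
      have := hl (Nat.pair k l) (Nat.right_le_pair k l)
      simpa [hh, hk] using this

theorem mem_NRC_of_containsOmegaSum [Infinite G] (hG : AddMonoid.ExponentExists G)
    {H : AddSubgroup G} (hH : (H : Set G).Countable)
    (hsum : ContainsOmegaSum G (AddMonoid.exponent H)) : H ∈ NRC G := by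
  have hm0 : AddMonoid.exponent G ≠ 0 := AddMonoid.exponent_ne_zero.2 hG
  have hexp : AddMonoid.exponent H ∣ AddMonoid.exponent G :=
    AddMonoid.exponent_dvd_of_forall_nsmul_eq_zero fun x =>
      Subtype.ext (AddMonoid.exponent_nsmul_eq_zero (x : G))
  have hHN (x : G) (hx : x ∈ H) : AddMonoid.exponent H • x = 0 :=
    congrArg Subtype.val (AddMonoid.exponent_nsmul_eq_zero (⟨x, hx⟩ : H))
  have hpos := Nat.pos_of_ne_zero (ne_zero_of_dvd_ne_zero hm0 hexp)
  rcases (Nat.succ_le_of_lt hpos).eq_or_lt with h1 | h1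
  -- If `exp H = 1`, a copy of `Z(1)^(ω)` is trivial and would make the topology discrete; a copy of
  -- `Z(p)^(ω)` replaces it.
  · obtain ⟨p, hp, -, hinf⟩ := exists_prime_infinite_torsion hm0 (⊤ : AddSubgroup G)
      Set.infinite_univ fun x _ => AddMonoid.exponent_nsmul_eq_zero x
    have hp1 : ContainsOmegaSum G (p ^ (0 + 1)) :=
      containsOmegaSum_of_infinite_torsion hp 0 (hinf.mono fun x hx => ⟨hx.2, x, by simp⟩)
    obtain ⟨φ, hφ⟩ := hp1.exists_injective
    refine mem_NRC_of_injective hG hH (by simpa using hp.two_le) (fun x hx => ?_) hφ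
    have := hHN x hx
    rw [← h1] at this
    rw [show x = 0 by simpa using this, smul_zero]
  · obtain ⟨φ, hφ⟩ := hsum.exists_injective
    exact mem_NRC_of_injective hG hH h1 hHN hφ

end Construction

theorem theorem2 {G : Type*} [AddCommGroup G] [Infinite G] (hG : AddMonoid.ExponentExists G)
    (H : AddSubgroup G) (hH : (H : Set G).Countable) :
    List.TFAE [ContainsOmegaSum G (AddMonoid.exponent H), H ∈ NRC G, H ∈ NR G] := by
  tfae_have 1 → 2 := mem_NRC_of_containsOmegaSum hG hH
  tfae_have 2 → 3 := fun ⟨τ, hτ, h1, _, h2, h3⟩ => ⟨τ, hτ, h1, h2, h3⟩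
  tfae_have 3 → 1 := containsOmegaSum_of_mem_NR hG
  tfae_finish
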